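/- A unit weighing matrix $UW(n,p)$ is a complex $n\times n$ matrix $W$ whose entries all have absolute value $0$ or $1$ and which satisfies $WW^*=pI_n$. Two unit weighing matrices $H,K$ of type $UW(n,p)$ are called unbiased if $HK^*=\sqrt{p}\,L$ for some unit weighing matrix $L$ of type $UW(n,p)$. A set of unit weighing matrices $UW(n,p)$ is called mutually unbiased if any two distinct members of it are unbiased. **Theorem.** Let $n\in\{3,4\}$ or $n\ge 6$, and let $S$ be a set of mutually unbiased unit weighing matrices $UW(n,3)$. Then $S$ is finite, and $|S|\le 3$ if $n\not\equiv 0 \pmod 4$, while $|S|\le 9$ if $n\equiv 0\pmod 4$. -/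

import Mathlib

/-- `W` is a unit weighing matrix `UW(n, p)`: a complex `n × n` matrix whose entries have absolute
value `0` or `1` and which satisfies `W W* = p I`. -/
structure IsUnitWeighing {n : ℕ} (p : ℕ) (W : Matrix (Fin n) (Fin n) ℂ) : Prop where
  norm_entry : ∀ i j, ‖W i j‖ = 0 ∨ ‖W i j‖ = 1
  mul_conjTranspose : W * W.conjTranspose = (p : ℂ) • (1 : Matrix (Fin n) (Fin n) ℂ)

/-- `H` and `K` are unbiased for weight `p`: `H K* = √p L` for some unit weighing matrix `L` of the
same order and weight. -/
def AreUnbiased {n : ℕ} (p : ℕ) (H K : Matrix (Fin n) (Fin n) ℂ) : Prop :=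
  ∃ L : Matrix (Fin n) (Fin n) ℂ,
    IsUnitWeighing p L ∧ H * K.conjTranspose = ((Real.sqrt (p : ℝ) : ℝ) : ℂ) • L

/-- A set of mutually unbiased unit weighing matrices `UW(n, p)`: all members are `UW(n, p)` and any
two distinct members are unbiased. -/
structure IsMutuallyUnbiased {n : ℕ} (p : ℕ) (S : Set (Matrix (Fin n) (Fin n) ℂ)) : Prop where
  isUnitWeighing : ∀ W ∈ S, IsUnitWeighing p W
  pairwise_unbiased : S.Pairwise (AreUnbiased p)

/-! Rows of members of `S` have three unimodular entries, and any inner product of two rows has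
modulus 0, √3 or 3. Supports meeting in a single point would give modulus 1, so this never happens,
within one member or between two. Fix one member `W`. Its supports are triples, three through each
point, and the exclusion of single intersections forces the triples through a point to span a set
`B` of size `d` = 3 or 4 which no row support of any member of `S` crosses
(`starUnion_card_and_pure`). The spans partition the points if all have size 4, so `4 ∤ n` yields
one of size 3.

Restricting all rows to `B` loses nothing: each row survives whole or vanishes. The `m` members of a
finite subset of `S`, with √3 I adjoined, give `k = m + 1` orthogonal systems in dimension `d` whose
cross inner products have squared modulus 0 or 3. The Welch bound of order two then reads `6k ≤ (d +
1)(k + 2)` (`card_bound_of_pure`), that is `m ≤ 3` for `d = 3` and `m ≤ 9` for `d = 4`. -/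

/-! ### Triple systems without single-point intersections. -/

/-- The union of the sets `R i` that contain `a`. -/
def starUnion {n : ℕ} (R : Fin n → Finset (Fin n)) (a : Fin n) : Finset (Fin n) :=
  (Finset.univ.filter (fun i => a ∈ R i)).biUnion R

theorem mem_starUnion {n : ℕ} {R : Fin n → Finset (Fin n)} {a j : Fin n} :
    j ∈ starUnion R a ↔ ∃ i, a ∈ R i ∧ j ∈ R i := by
  simp [starUnion]

/-- Two sets that do not meet in exactly one point share a second point whenever they share one. -/
theorem card_inter_ne_one_elim {n : ℕ} {F G : Finset (Fin n)} (h : (F ∩ G).card ≠ 1)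
    {x : Fin n} (hF : x ∈ F) (hG : x ∈ G) : ∃ y, y ≠ x ∧ y ∈ F ∧ y ∈ G := by
  by_contra! hc
  apply h
  rw [Finset.card_eq_one]
  refine ⟨x, ?_⟩
  ext y
  simp only [Finset.mem_inter, Finset.mem_singleton]
  constructor
  · rintro ⟨h1, h2⟩
    by_contra h3
    exact hc y h3 h1 h2
  · rintro rfl
    exact ⟨hF, hG⟩

/-- A family of `n` triples in an `n`-set, each point on three of them, no two of them meeting in
exactly one point: the triples through a point span three or four points, and no triple which meets
all members of the family in a number of points other than one crosses that span. -/
theorem starUnion_card_and_pure {n : ℕ} (R : Fin n → Finset (Fin n))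
    (hrow : ∀ i, (R i).card = 3)
    (hcol : ∀ j, (Finset.univ.filter (fun i => j ∈ R i)).card = 3)
    (hmeet : ∀ i j, (R i ∩ R j).card ≠ 1) (a : Fin n) :
    ((starUnion R a).card = 3 ∨ (starUnion R a).card = 4) ∧
      ∀ F : Finset (Fin n), F.card = 3 → (∀ i, (F ∩ R i).card ≠ 1) →
        (∀ x ∈ F, x ∈ starUnion R a) ∨ ∀ x ∈ F, x ∉ starUnion R a := by
  classical
  obtain ⟨i₁, i₂, i₃, h12, h13, h23, hi⟩ := Finset.card_eq_three.1 (hcol a)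
  have hmem : ∀ i, a ∈ R i ↔ i = i₁ ∨ i = i₂ ∨ i = i₃ := by
    intro i
    have := Finset.ext_iff.1 hi i
    simpa using this
  have ha1 : a ∈ R i₁ := (hmem _).2 (by simp)
  have ha2 : a ∈ R i₂ := (hmem _).2 (by simp)
  have ha3 : a ∈ R i₃ := (hmem _).2 (by simp)
  have hB : ∀ x, x ∈ starUnion R a ↔ x ∈ R i₁ ∨ x ∈ R i₂ ∨ x ∈ R i₃ := by
    intro x
    rw [mem_starUnion]
    constructor
    · rintro ⟨i, h1, h2⟩
      rcases (hmem i).1 h1 with rfl | rfl | rfl <;> simp [h2]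
    · rintro (h | h | h)
      exacts [⟨_, ha1, h⟩, ⟨_, ha2, h⟩, ⟨_, ha3, h⟩]
  have hsub : ∀ x, (∀ i, x ∈ R i → i = i₁ ∨ i = i₂ ∨ i = i₃) →
      x ∈ R i₁ ∧ x ∈ R i₂ ∧ x ∈ R i₃ := by
    intro x hx
    have hs : Finset.univ.filter (fun i => x ∈ R i) ⊆ {i₁, i₂, i₃} := by
      intro i hi'
      have := hx i (by simpa using hi')
      simpa using this
    have he := Finset.eq_of_subset_of_card_le hs (by
      rw [hcol x]
      exact Finset.card_le_three)
    have := Finset.ext_iff.1 he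
    simp only [Finset.mem_filter, Finset.mem_univ, true_and, Finset.mem_insert,
      Finset.mem_singleton] at this
    exact ⟨(this _).2 (by simp), (this _).2 (by simp), (this _).2 (by simp)⟩
  have hsat : ∀ x, x ∈ R i₁ → x ∈ R i₂ → x ∈ R i₃ → ∀ i, x ∈ R i → i = i₁ ∨ i = i₂ ∨ i = i₃ := by
    intro x h1 h2 h3 i hxi
    have hs : ({i₁, i₂, i₃} : Finset (Fin n)) ⊆ Finset.univ.filter (fun i => x ∈ R i) := by
      intro j hj
      simp only [Finset.mem_insert, Finset.mem_singleton] at hj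
      rcases hj with rfl | rfl | rfl <;> simp [*]
    have he := Finset.eq_of_subset_of_card_le hs (by
      rw [hcol x, Finset.card_eq_three.2 ⟨i₁, i₂, i₃, h12, h13, h23, rfl⟩])
    have := (Finset.ext_iff.1 he i).2 (by simpa using hxi)
    simpa using this
  -- a second common point of the three triples forces them to be equal
  have hcommon : ∀ b, b ≠ a → b ∈ R i₁ → b ∈ R i₂ → b ∈ R i₃ →
      ∀ j, (j = i₁ ∨ j = i₂ ∨ j = i₃) → ∀ x ∈ R j, x ∈ R i₁ ∧ x ∈ R i₂ ∧ x ∈ R i₃ := by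
    intro b hba hb1 hb2 hb3 j hj x hx
    apply hsub
    intro i hxi
    have haj : a ∈ R j := (hmem j).2 hj
    have hbj : b ∈ R j := by rcases hj with rfl | rfl | rfl <;> assumption
    by_cases hxa : x = a
    · exact (hmem i).1 (hxa ▸ hxi)
    by_cases hxb : x = b
    · exact hsat b hb1 hb2 hb3 i (hxb ▸ hxi)
    obtain ⟨y, hyx, hyi, hyj⟩ := card_inter_ne_one_elim (hmeet i j) hxi hx
    have hRj : R j = {a, b, x} := by
      symm
      apply Finset.eq_of_subset_of_card_le
      · intro z hz
        simp only [Finset.mem_insert, Finset.mem_singleton] at hz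
        rcases hz with rfl | rfl | rfl <;> assumption
      · rw [hrow, Finset.card_eq_three.2 ⟨a, b, x, hba.symm, Ne.symm hxa, Ne.symm hxb, rfl⟩]
    rw [hRj] at hyj
    simp only [Finset.mem_insert, Finset.mem_singleton] at hyj
    rcases hyj with rfl | rfl | rfl
    · exact (hmem i).1 hyi
    · exact hsat y hb1 hb2 hb3 i hyi
    · exact absurd rfl hyx
  -- Either the three triples through `a` coincide, or they are `abc`, `abd`, `acd` inside a 4-set.
  by_cases hall : ∃ b, b ≠ a ∧ b ∈ R i₁ ∧ b ∈ R i₂ ∧ b ∈ R i₃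
  · obtain ⟨b, hba, hb1, hb2, hb3⟩ := hall
    have hc := hcommon b hba hb1 hb2 hb3
    have hBe : starUnion R a = R i₁ := by
      ext x
      rw [hB]
      constructor
      · rintro (h | h | h)
        exacts [h, (hc i₂ (by simp) x h).1, (hc i₃ (by simp) x h).1]
      · exact Or.inl
    refine ⟨Or.inl (by rw [hBe, hrow]), ?_⟩
    intro F hF hFR
    rw [hBe]
    by_contra! hcon
    obtain ⟨⟨y, hyF, hyR⟩, x, hxF, hxR⟩ := hcon
    obtain ⟨z, hzx, hzF, hzR⟩ := card_inter_ne_one_elim (hFR i₁) hxF hxR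
    have hyx : y ≠ x := by rintro rfl; exact hyR hxR
    have hyz : y ≠ z := by rintro rfl; exact hyR hzR
    have hFe : F = {x, y, z} := by
      symm
      apply Finset.eq_of_subset_of_card_le
      · intro w hw
        simp only [Finset.mem_insert, Finset.mem_singleton] at hw
        rcases hw with rfl | rfl | rfl <;> assumption
      · rw [hF, Finset.card_eq_three.2 ⟨x, y, z, hyx.symm, hzx.symm, hyz, rfl⟩]
    -- A triple through `y` avoids `R i₁`, whose points already have their three triples, so it
    -- meets `F` only in `y`.
    obtain ⟨i, hi⟩ : ∃ i, y ∈ R i := by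
      have : (Finset.univ.filter (fun i => y ∈ R i)).Nonempty := by
        rw [← Finset.card_pos, hcol]; norm_num
      obtain ⟨i, hi⟩ := this
      exact ⟨i, by simpa using hi⟩
    have hnot : ∀ w ∈ R i₁, w ∉ R i := by
      intro w hw hwi
      obtain ⟨w1, w2, w3⟩ := hc i₁ (by simp) w hw
      have := hsat w w1 w2 w3 i hwi
      exact hyR (hc i this y hi).1
    obtain ⟨w, hwy, hwF, hwi⟩ := card_inter_ne_one_elim (hFR i) hyF hi
    rw [hFe] at hwF
    simp only [Finset.mem_insert, Finset.mem_singleton] at hwF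
    rcases hwF with rfl | rfl | rfl
    · exact hnot _ hxR hwi
    · exact hwy rfl
    · exact hnot _ hzR hwi
  · push Not at hall
    obtain ⟨b, hba, hb1, hb2⟩ := card_inter_ne_one_elim (hmeet i₁ i₂) ha1 ha2
    obtain ⟨c, hca, hc1, hc3⟩ := card_inter_ne_one_elim (hmeet i₁ i₃) ha1 ha3
    obtain ⟨d, hda, hd2, hd3⟩ := card_inter_ne_one_elim (hmeet i₂ i₃) ha2 ha3
    have hb3 := hall b hba hb1 hb2
    have hbc : b ≠ c := by rintro rfl; exact hb3 hc3
    have hbd : b ≠ d := by rintro rfl; exact hb3 hd3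
    have hcd : c ≠ d := by rintro rfl; exact hall c hca hc1 hd2 hc3
    have hR : ∀ i x y, x ≠ a → y ≠ a → x ≠ y → a ∈ R i → x ∈ R i → y ∈ R i → R i = {a, x, y} := by
      intro i x y hx hy hxy h1 h2 h3
      symm
      apply Finset.eq_of_subset_of_card_le
      · intro z hz
        simp only [Finset.mem_insert, Finset.mem_singleton] at hz
        rcases hz with rfl | rfl | rfl <;> assumption
      · rw [hrow, Finset.card_eq_three.2 ⟨a, x, y, hx.symm, hy.symm, hxy, rfl⟩]
    have e1 := hR i₁ b c hba hca hbc ha1 hb1 hc1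
    have e2 := hR i₂ b d hba hda hbd ha2 hb2 hd2
    have e3 := hR i₃ c d hca hda hcd ha3 hc3 hd3
    have hBe : starUnion R a = {a, b, c, d} := by
      ext x
      rw [hB, e1, e2, e3]
      simp only [Finset.mem_insert, Finset.mem_singleton]
      tauto
    refine ⟨Or.inr ?_, ?_⟩
    · rw [hBe]
      simp [hba.symm, hca.symm, hda.symm, hbc, hbd, hcd]
    · intro F hF hFR
      have k : ∀ i, ∀ x, x ∈ F → x ∈ R i → ∃ y, y ≠ x ∧ y ∈ F ∧ y ∈ R i := fun i x h1 h2 =>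
        card_inter_ne_one_elim (hFR i) h1 h2
      have k1 := k i₁
      have k2 := k i₂
      have k3 := k i₃
      rw [e1] at k1
      rw [e2] at k2
      rw [e3] at k3
      simp only [Finset.mem_insert, Finset.mem_singleton] at k1 k2 k3
      have three : ∀ x y z, x ∈ F → y ∈ F → z ∈ F → x ≠ y → x ≠ z → y ≠ z → F = {x, y, z} := by
        intro x y z h1 h2 h3 h4 h5 h6
        symm
        apply Finset.eq_of_subset_of_card_le
        · intro z hz
          simp only [Finset.mem_insert, Finset.mem_singleton] at hz
          rcases hz with rfl | rfl | rfl <;> assumption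
        · rw [hF, Finset.card_eq_three.2 ⟨x, y, z, h4, h5, h6, rfl⟩]
      -- If `F` held exactly one or two of the four points, one of `abc`, `abd`, `acd` would meet it
      -- in a single point.
      have fin : (a ∈ F ∧ b ∈ F ∧ c ∈ F) ∨ (a ∈ F ∧ b ∈ F ∧ d ∈ F) ∨ (a ∈ F ∧ c ∈ F ∧ d ∈ F) ∨
          (b ∈ F ∧ c ∈ F ∧ d ∈ F) ∨ (a ∉ F ∧ b ∉ F ∧ c ∉ F ∧ d ∉ F) := by
        have p1 : ∀ x, (x = a ∨ x = b ∨ x = c) → x ∈ F →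
            ((a ∈ F ∧ b ∈ F) ∨ (a ∈ F ∧ c ∈ F) ∨ (b ∈ F ∧ c ∈ F)) := by
          intro x hx hxF
          obtain ⟨y, hy1, hy2, hy3⟩ := k1 x hxF hx
          rcases hx with rfl | rfl | rfl <;> rcases hy3 with rfl | rfl | rfl <;> tauto
        have p2 : ∀ x, (x = a ∨ x = b ∨ x = d) → x ∈ F →
            ((a ∈ F ∧ b ∈ F) ∨ (a ∈ F ∧ d ∈ F) ∨ (b ∈ F ∧ d ∈ F)) := by
          intro x hx hxF
          obtain ⟨y, hy1, hy2, hy3⟩ := k2 x hxF hx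
          rcases hx with rfl | rfl | rfl <;> rcases hy3 with rfl | rfl | rfl <;> tauto
        have p3 : ∀ x, (x = a ∨ x = c ∨ x = d) → x ∈ F →
            ((a ∈ F ∧ c ∈ F) ∨ (a ∈ F ∧ d ∈ F) ∨ (c ∈ F ∧ d ∈ F)) := by
          intro x hx hxF
          obtain ⟨y, hy1, hy2, hy3⟩ := k3 x hxF hx
          rcases hx with rfl | rfl | rfl <;> rcases hy3 with rfl | rfl | rfl <;> tauto
        have q1a := p1 a (by simp)
        have q1b := p1 b (by simp)
        have q1c := p1 c (by simp)
        have q2a := p2 a (by simp)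
        have q2b := p2 b (by simp)
        have q2d := p2 d (by simp)
        have q3a := p3 a (by simp)
        have q3c := p3 c (by simp)
        have q3d := p3 d (by simp)
        clear p1 p2 p3 k1 k2 k3 k three hFR hR e1 e2 e3 hBe hsub hsat hcommon hmem hB hall hi hrow hcol
        grind
      rw [hBe]
      rcases fin with ⟨h1, h2, h3⟩ | ⟨h1, h2, h3⟩ | ⟨h1, h2, h3⟩ | ⟨h1, h2, h3⟩ | h
      · left; rw [three _ _ _ h1 h2 h3 hba.symm hca.symm hbc]; intro x hx; simp at hx ⊢; tauto
      · left; rw [three _ _ _ h1 h2 h3 hba.symm hda.symm hbd]; intro x hx; simp at hx ⊢; tauto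
      · left; rw [three _ _ _ h1 h2 h3 hca.symm hda.symm hcd]; intro x hx; simp at hx ⊢; tauto
      · left; rw [three _ _ _ h1 h2 h3 hbc hbd hcd]; intro x hx; simp at hx ⊢; tauto
      · right
        intro x hx hxB
        simp only [Finset.mem_insert, Finset.mem_singleton] at hxB
        rcases hxB with rfl | rfl | rfl | rfl <;> tauto

/-- If `4 ∤ n` then some of the spans in `starUnion_card_and_pure` has three points. -/
theorem exists_starUnion_card_eq_three {n : ℕ} (R : Fin n → Finset (Fin n))
    (hrow : ∀ i, (R i).card = 3)
    (hcol : ∀ j, (Finset.univ.filter (fun i => j ∈ R i)).card = 3)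
    (hmeet : ∀ i j, (R i ∩ R j).card ≠ 1) (hn : ¬ n ≡ 0 [MOD 4]) :
    ∃ a, (starUnion R a).card = 3 := by
  classical
  by_contra! hne
  have key := starUnion_card_and_pure R hrow hcol hmeet
  have h4 : ∀ a, (starUnion R a).card = 4 := fun a => (key a).1.resolve_left (hne a)
  have hself : ∀ a, a ∈ starUnion R a := by
    intro a
    have : (Finset.univ.filter (fun i => a ∈ R i)).Nonempty := by
      rw [← Finset.card_pos, hcol]; norm_num
    obtain ⟨i, hi⟩ := this
    have hi' : a ∈ R i := by simpa using hi
    exact mem_starUnion.2 ⟨i, hi', hi'⟩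
  -- Purity makes the spans the classes of a partition: a triple through `j` cannot leave the span
  -- of `a`.
  have heq : ∀ a j, j ∈ starUnion R a → starUnion R j = starUnion R a := by
    intro a j hj
    apply Finset.eq_of_subset_of_card_le
    · intro x hx
      obtain ⟨i, hji, hxi⟩ := mem_starUnion.1 hx
      rcases (key a).2 (R i) (hrow i) (fun k => hmeet i k) with h | h
      · exact h x hxi
      · exact absurd hj (h j hji)
    · rw [h4, h4]
  have hcount := Finset.card_eq_sum_card_image (starUnion R) (Finset.univ : Finset (Fin n))
  have hfib : ∀ B ∈ Finset.univ.image (starUnion R),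
      (Finset.univ.filter (fun j => starUnion R j = B)).card = 4 := by
    intro B hB
    obtain ⟨a, -, rfl⟩ := Finset.mem_image.1 hB
    rw [← h4 a]
    congr 1
    ext j
    simp only [Finset.mem_filter, Finset.mem_univ, true_and]
    exact ⟨fun h => h ▸ hself j, heq a j⟩
  rw [Finset.sum_congr rfl hfib] at hcount
  simp only [Finset.card_univ, Fintype.card_fin, Finset.sum_const, smul_eq_mul] at hcount
  apply hn
  rw [Nat.modEq_zero_iff_dvd]
  exact ⟨_, by rw [hcount, mul_comm]⟩

/-! ### The Welch bound of order two. -/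

/-- The fourth tensor power `v ⊗ v ⊗ v̄ ⊗ v̄` of a complex vector. -/
noncomputable def quarticTensor {D : Type*} [Fintype D] (v : D → ℂ) :
    EuclideanSpace ℂ ((D × D) × (D × D)) :=
  WithLp.toLp 2 fun p => (v p.1.1 * v p.1.2) * (star (v p.2.1) * star (v p.2.2))

/-- Twice the orthogonal projection onto symmetric tensors of degree two. -/
noncomputable def symmetrizer (D : Type*) [Fintype D] [DecidableEq D] :
    EuclideanSpace ℂ ((D × D) × (D × D)) :=
  WithLp.toLp 2 fun p => (if p.1.1 = p.2.1 then 1 else 0) * (if p.1.2 = p.2.2 then 1 else 0) +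
    (if p.1.1 = p.2.2 then 1 else 0) * (if p.1.2 = p.2.1 then 1 else 0)

theorem inner_quarticTensor {D : Type*} [Fintype D] (v w : D → ℂ) :
    inner ℂ (quarticTensor v) (quarticTensor w) =
      ((Complex.normSq (∑ k, v k * star (w k)) ^ 2 : ℝ) : ℂ) := by
  have h1 : (∑ k, w k * star (v k)) = star (∑ k, v k * star (w k)) := by
    simp [star_sum, mul_comm]
  have h2 : ((Complex.normSq (∑ k, v k * star (w k)) ^ 2 : ℝ) : ℂ) =
      ((∑ k, w k * star (v k)) * (∑ k, w k * star (v k))) *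
        ((∑ k, v k * star (w k)) * (∑ k, v k * star (w k))) := by
    rw [h1]
    push_cast
    rw [Complex.normSq_eq_conj_mul_self]
    simp only [starRingEnd_apply]
    ring
  rw [h2, Finset.sum_mul_sum, Finset.sum_mul_sum]
  simp only [← Fintype.sum_prod_type']
  rw [Finset.sum_mul_sum]
  simp only [← Fintype.sum_prod_type']
  rw [PiLp.inner_apply]
  refine Finset.sum_congr rfl fun p _ => ?_
  simp only [quarticTensor, RCLike.inner_apply, map_mul, starRingEnd_apply, star_star]
  ring

theorem inner_symmetrizer_quarticTensor {D : Type*} [Fintype D] [DecidableEq D] (v : D → ℂ) :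
    inner ℂ (symmetrizer D) (quarticTensor v) = 2 * (∑ k, v k * star (v k)) ^ 2 := by
  rw [PiLp.inner_apply]
  simp only [symmetrizer, quarticTensor, RCLike.inner_apply, Fintype.sum_prod_type, map_add,
    map_mul, apply_ite (starRingEnd ℂ), map_one, map_zero, mul_add, Finset.sum_add_distrib]
  simp only [mul_ite, mul_one, mul_zero,
    Finset.sum_ite_eq, Finset.mem_univ, if_true]
  rw [sq, Finset.sum_mul_sum, two_mul]
  refine congrArg₂ (· + ·) ?_ ?_ <;>
    refine Finset.sum_congr rfl fun i _ => Finset.sum_congr rfl fun j _ => ?_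
  · ring
  · have : ∀ k l : D, (if j = k then if i = l then v i * v j * (star (v k) * star (v l)) else 0
        else 0) = if i = l then if j = k then v i * v j * (star (v k) * star (v l)) else 0
          else 0 := by
      intro k l
      split_ifs <;> rfl
    simp only [this, Finset.sum_ite_eq, Finset.mem_univ, if_true]
    ring

theorem norm_sq_symmetrizer (D : Type*) [Fintype D] [DecidableEq D] :
    ‖symmetrizer D‖ ^ 2 = 2 * (Fintype.card D : ℝ) * (Fintype.card D + 1) := by
  -- After summation the two squares give d² each and the cross term, where all four indices agree,
  -- gives 2d.
  have e : ∀ P Q R S : Prop, ∀ [Decidable P] [Decidable Q] [Decidable R] [Decidable S],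
      ‖((if P then 1 else 0) * (if Q then 1 else 0) + (if R then 1 else 0) * (if S then 1 else 0)
        : ℂ)‖ ^ 2 = (if P then if Q then 1 else 0 else 0) + (if R then if S then 1 else 0 else 0) +
          2 * (if P then if Q then if R then if S then 1 else 0 else 0 else 0 else 0) := by
    intro P Q R S _ _ _ _
    split_ifs <;> norm_num
  rw [EuclideanSpace.norm_sq_eq]
  simp only [symmetrizer, e, Fintype.sum_prod_type, Finset.sum_add_distrib, ← Finset.mul_sum]
  simp
  ring

/-- The Welch bound of order two, for vectors that need not be normalized. -/
theorem welch_bound_two {D X : Type*} [Fintype D] [DecidableEq D] [Fintype X] (v : X → D → ℂ) :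
    2 * (∑ x, (∑ k, Complex.normSq (v x k)) ^ 2) ^ 2 ≤
      (Fintype.card D : ℝ) * (Fintype.card D + 1) *
        ∑ x, ∑ y, Complex.normSq (∑ k, v x k * star (v y k)) ^ 2 := by
  set A := ∑ x, quarticTensor (v x) with hA
  have h1 : inner ℂ (symmetrizer D) A =
      ((2 * ∑ x, (∑ k, Complex.normSq (v x k)) ^ 2 : ℝ) : ℂ) := by
    rw [hA, inner_sum]
    simp only [inner_symmetrizer_quarticTensor]
    push_cast
    rw [Finset.mul_sum]
    refine Finset.sum_congr rfl fun x _ => ?_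
    congr 2
    refine Finset.sum_congr rfl fun k _ => ?_
    rw [Complex.normSq_eq_conj_mul_self, mul_comm]
    rfl
  have h2 : ‖A‖ ^ 2 = ∑ x, ∑ y, Complex.normSq (∑ k, v x k * star (v y k)) ^ 2 := by
    have : inner ℂ A A = ((∑ x, ∑ y, Complex.normSq (∑ k, v x k * star (v y k)) ^ 2 : ℝ) : ℂ) := by
      rw [hA, sum_inner]
      simp only [inner_sum, inner_quarticTensor]
      push_cast
      rfl
    rw [inner_self_eq_norm_sq_to_K] at this
    apply Complex.ofReal_injective
    rw [← this]
    simp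
  -- The Welch bound is Cauchy–Schwarz between the symmetrizer and the sum of the quartic tensors.
  have h3 := norm_inner_le_norm (𝕜 := ℂ) (symmetrizer D) A
  rw [h1, Complex.norm_real, Real.norm_eq_abs] at h3
  have h4 := mul_self_le_mul_self (abs_nonneg _) h3
  rw [abs_mul_abs_self] at h4
  have h5 := norm_sq_symmetrizer D
  have h6 : (‖symmetrizer D‖ * ‖A‖) * (‖symmetrizer D‖ * ‖A‖) =
      ‖symmetrizer D‖ ^ 2 * ‖A‖ ^ 2 := by ring
  rw [h6, h5, h2] at h4
  linarith

/-- The second moment of a tight frame. -/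
theorem sum_normSq_inner_of_tight {D X : Type*} [Fintype D] [DecidableEq D] [Fintype X]
    (v : X → D → ℂ) (c : ℝ)
    (h : ∀ k l, ∑ x, star (v x k) * v x l = if k = l then (c : ℂ) else 0) :
    ∑ x, ∑ y, Complex.normSq (∑ k, v x k * star (v y k)) = c ^ 2 * Fintype.card D := by
  have : ((∑ x, ∑ y, Complex.normSq (∑ k, v x k * star (v y k)) : ℝ) : ℂ) =
      ((c ^ 2 * Fintype.card D : ℝ) : ℂ) := by
    push_cast
    have e : ∀ x y, ((Complex.normSq (∑ k, v x k * star (v y k)) : ℝ) : ℂ) =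
        ∑ k, ∑ l, (star (v x k) * v x l) * (star (v y l) * v y k) := by
      intro x y
      rw [Complex.normSq_eq_conj_mul_self, map_sum, Finset.sum_mul_sum]
      refine Finset.sum_congr rfl fun k _ => Finset.sum_congr rfl fun l _ => ?_
      simp only [map_mul, starRingEnd_apply, star_star]
      ring
    simp only [e]
    have : ∑ x, ∑ y, ∑ k, ∑ l, (star (v x k) * v x l) * (star (v y l) * v y k) =
        ∑ k, ∑ l, (∑ x, star (v x k) * v x l) * (∑ y, star (v y l) * v y k) := by
      simp only [Finset.sum_mul_sum]
      calc _ = ∑ x, ∑ k, ∑ y, ∑ l, (star (v x k) * v x l) * (star (v y l) * v y k) :=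
            Finset.sum_congr rfl fun x _ => Finset.sum_comm
        _ = ∑ k, ∑ x, ∑ y, ∑ l, (star (v x k) * v x l) * (star (v y l) * v y k) :=
            Finset.sum_comm
        _ = ∑ k, ∑ x, ∑ l, ∑ y, (star (v x k) * v x l) * (star (v y l) * v y k) :=
            Finset.sum_congr rfl fun k _ => Finset.sum_congr rfl fun x _ => Finset.sum_comm
        _ = _ := Finset.sum_congr rfl fun k _ => Finset.sum_comm
    rw [this]
    simp only [h]
    simp [sq, mul_comm]
  exact_mod_cast this

/-! ### The Welch bound for rows that do not cross a block. -/

/-- The Welch bound for a family of matrices with orthogonal rows of squared norm `3`, each row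
supported in `B` or in its complement, where rows of distinct matrices have inner products of
squared modulus `0` or `3`. -/
theorem card_bound_of_pure {n : ℕ} {ι : Type*} [Fintype ι] [Nonempty ι]
    (M : ι → Matrix (Fin n) (Fin n) ℂ) (B : Finset (Fin n)) (hB : B.Nonempty)
    (h1 : ∀ a, M a * (M a).conjTranspose = (3 : ℂ) • (1 : Matrix (Fin n) (Fin n) ℂ))
    (h2 : ∀ a i, (∀ j ∈ B, M a i j = 0) ∨ (∀ j ∉ B, M a i j = 0))
    (h3 : ∀ a b, a ≠ b → ∀ i j, Complex.normSq ((M a * (M b).conjTranspose) i j) = 0 ∨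
      Complex.normSq ((M a * (M b).conjTranspose) i j) = 3) :
    6 * Fintype.card ι ≤ (B.card + 1) * (2 + Fintype.card ι) := by
  classical
  let v : ι × Fin n → B → ℂ := fun x k => M x.1 x.2 k
  let t : ι × Fin n → ι × Fin n → ℝ := fun x y => Complex.normSq (∑ k, v x k * star (v y k))
  have hsum : ∀ x y, (∑ k, v x k * star (v y k)) = 0 ∨
      (∑ k, v x k * star (v y k)) = (M x.1 * (M y.1).conjTranspose) x.2 y.2 := by
    intro x y
    rcases h2 x.1 x.2 with h | h
    · left
      exact Finset.sum_eq_zero fun k _ => by simp [v, h k k.2]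
    · right
      rw [Matrix.mul_apply]
      simp only [Matrix.conjTranspose_apply, v]
      rw [Finset.sum_coe_sort B (fun k => M x.1 x.2 k * star (M y.1 y.2 k))]
      exact Finset.sum_subset (Finset.subset_univ _) fun k _ hk => by rw [h k hk, zero_mul]
  have hdiag : ∀ x, ((∑ k, Complex.normSq (v x k) : ℝ) : ℂ) = ∑ k, v x k * star (v x k) := by
    intro x
    push_cast
    exact Finset.sum_congr rfl fun k _ => by
      rw [Complex.normSq_eq_conj_mul_self, mul_comm]; rfl
  have hnorm : ∀ x, (∑ k, Complex.normSq (v x k)) = 0 ∨ (∑ k, Complex.normSq (v x k)) = 3 := by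
    intro x
    rcases hsum x x with h | h
    · left
      apply Complex.ofReal_injective
      rw [hdiag, h, Complex.ofReal_zero]
    · right
      apply Complex.ofReal_injective
      rw [hdiag, h, h1]
      simp
  -- Off the diagonal `t` is 0 or 3, so `t² = 3t`; on it a surviving row has `t = 9`, and 81 = 3·9 +
  -- 18·3. The fourth moment thus reduces to the second, which tightness determines.
  have htt : ∀ x y, t x y ^ 2 = 3 * t x y +
      if x = y then 18 * ∑ k, Complex.normSq (v x k) else 0 := by
    intro x y
    by_cases hxy : x = y
    · subst hxy
      have : t x x = (∑ k, Complex.normSq (v x k)) ^ 2 := by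
        simp only [t]
        rw [← hdiag, Complex.normSq_ofReal, sq]
      rw [this, if_pos rfl]
      rcases hnorm x with h | h <;> rw [h] <;> norm_num
    · rw [if_neg hxy]
      have : t x y = 0 ∨ t x y = 3 := by
        simp only [t]
        rcases hsum x y with h | h
        · left; rw [h]; simp
        · rw [h]
          by_cases hab : x.1 = y.1
          · left
            have hij : x.2 ≠ y.2 := fun h => hxy (Prod.ext hab h)
            rw [hab, h1]
            simp [Matrix.one_apply_ne hij]
          · exact h3 _ _ hab _ _
      rcases this with h | h <;> rw [h] <;> norm_num
  have hcols : ∀ a, (M a).conjTranspose * M a = (3 : ℂ) • (1 : Matrix (Fin n) (Fin n) ℂ) := by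
    intro a
    have e : M a * ((3 : ℂ)⁻¹ • (M a).conjTranspose) = 1 := by
      rw [Matrix.mul_smul, h1, smul_smul]; norm_num
    have e' := mul_eq_one_comm.1 e
    rw [Matrix.smul_mul] at e'
    rw [← e', smul_smul]; norm_num
  have htight : ∀ k l, ∑ x, star (v x k) * v x l =
      if k = l then ((3 * Fintype.card ι : ℝ) : ℂ) else 0 := by
    intro k l
    rw [Fintype.sum_prod_type]
    have : ∀ a, ∑ i, star (v (a, i) k) * v (a, i) l = if k = l then 3 else 0 := by
      intro a
      have := congrFun (congrFun (hcols a) k) l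
      rw [Matrix.mul_apply] at this
      simp only [Matrix.conjTranspose_apply, Matrix.smul_apply, Matrix.one_apply,
        smul_eq_mul, mul_ite, mul_one, mul_zero] at this
      simp only [v, this, Subtype.ext_iff]
    simp only [this]
    split_ifs <;> simp [mul_comm]
  have hN : ∑ x, ∑ k, Complex.normSq (v x k) = 3 * Fintype.card ι * B.card := by
    rw [Finset.sum_comm]
    have : ∀ k, ∑ x, Complex.normSq (v x k) = 3 * Fintype.card ι := by
      intro k
      apply Complex.ofReal_injective
      have := htight k k
      rw [if_pos rfl] at this
      rw [← this]
      push_cast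
      exact Finset.sum_congr rfl fun x _ => Complex.normSq_eq_conj_mul_self
    simp [this, mul_comm]
  have hT : ∑ x, (∑ k, Complex.normSq (v x k)) ^ 2 = 9 * Fintype.card ι * B.card := by
    have : ∀ x, (∑ k, Complex.normSq (v x k)) ^ 2 = 3 * ∑ k, Complex.normSq (v x k) := by
      intro x
      rcases hnorm x with h | h <;> rw [h] <;> norm_num
    simp only [this]
    rw [← Finset.mul_sum, hN]
    ring
  have hsecond := sum_normSq_inner_of_tight v _ htight
  have hQ : ∑ x, ∑ y, t x y ^ 2 =
      3 * ((3 * Fintype.card ι) ^ 2 * B.card) + 18 * (3 * Fintype.card ι * B.card) := by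
    simp only [htt, Finset.sum_add_distrib, Finset.sum_ite_eq, Finset.mem_univ, if_true,
      ← Finset.mul_sum]
    rw [hN]
    simp only [t]
    rw [hsecond, Fintype.card_coe]
  have hW := welch_bound_two v
  rw [hT, hQ, Fintype.card_coe] at hW
  have hm : (0 : ℝ) < Fintype.card ι := by exact_mod_cast Fintype.card_pos
  have hd : (0 : ℝ) < B.card := by exact_mod_cast hB.card_pos
  have hfin : (6 * Fintype.card ι : ℝ) ≤ (B.card + 1) * (2 + Fintype.card ι) := by
    -- The common factor of 2(9kd)² and d(d+1)(27k²d + 54kd).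
    have hp : (0 : ℝ) < 27 * Fintype.card ι * B.card * B.card := by positivity
    refine le_of_mul_le_mul_left ?_ hp
    linarith
  exact_mod_cast hfin

/-! ### Row supports of unit weighing matrices. -/

/-- The set of columns where row `i` of `W` does not vanish. -/
noncomputable def rowSupport {n : ℕ} (W : Matrix (Fin n) (Fin n) ℂ) (i : Fin n) : Finset (Fin n) :=
  Finset.univ.filter fun j => ‖W i j‖ = 1

theorem IsUnitWeighing.eq_zero_of_notMem {n p : ℕ} {W : Matrix (Fin n) (Fin n) ℂ}
    (hW : IsUnitWeighing p W) {i j : Fin n} (h : j ∉ rowSupport W i) : W i j = 0 := by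
  have : ‖W i j‖ ≠ 1 := by simpa [rowSupport] using h
  exact norm_eq_zero.1 ((hW.norm_entry i j).resolve_right this)

theorem IsUnitWeighing.conjTranspose_mul {n p : ℕ} (hp : p ≠ 0) {W : Matrix (Fin n) (Fin n) ℂ}
    (hW : IsUnitWeighing p W) :
    W.conjTranspose * W = (p : ℂ) • (1 : Matrix (Fin n) (Fin n) ℂ) := by
  have hp' : (p : ℂ) ≠ 0 := by exact_mod_cast hp
  have e : W * ((p : ℂ)⁻¹ • W.conjTranspose) = 1 := by
    rw [Matrix.mul_smul, hW.mul_conjTranspose, smul_smul, inv_mul_cancel₀ hp', one_smul]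
  have e' := mul_eq_one_comm.1 e
  rw [Matrix.smul_mul] at e'
  rw [← e', smul_smul, mul_inv_cancel₀ hp', one_smul]

theorem IsUnitWeighing.mul_star_self {n p : ℕ} {W : Matrix (Fin n) (Fin n) ℂ}
    (hW : IsUnitWeighing p W) (i j : Fin n) :
    W i j * star (W i j) = if ‖W i j‖ = 1 then 1 else 0 := by
  have : W i j * star (W i j) = ((‖W i j‖ ^ 2 : ℝ) : ℂ) := by
    rw [← Complex.normSq_eq_norm_sq, Complex.normSq_eq_conj_mul_self, mul_comm]; rfl
  rw [this]
  rcases hW.norm_entry i j with h | h <;> simp [h]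

theorem IsUnitWeighing.card_rowSupport {n p : ℕ} {W : Matrix (Fin n) (Fin n) ℂ}
    (hW : IsUnitWeighing p W) (i : Fin n) : (rowSupport W i).card = p := by
  have h := congrFun (congrFun hW.mul_conjTranspose i) i
  rw [Matrix.mul_apply] at h
  simp only [Matrix.conjTranspose_apply, hW.mul_star_self] at h
  rw [← Finset.sum_filter] at h
  have : ((rowSupport W i).card : ℂ) = p := by simpa [rowSupport] using h
  exact_mod_cast this

theorem IsUnitWeighing.card_filter_mem_rowSupport {n p : ℕ} (hp : p ≠ 0)
    {W : Matrix (Fin n) (Fin n) ℂ} (hW : IsUnitWeighing p W) (j : Fin n) :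
    (Finset.univ.filter fun i => j ∈ rowSupport W i).card = p := by
  have h := congrFun (congrFun (hW.conjTranspose_mul hp) j) j
  rw [Matrix.mul_apply] at h
  simp only [Matrix.conjTranspose_apply, mul_comm (star (W _ _)), hW.mul_star_self] at h
  rw [← Finset.sum_filter] at h
  have : ((Finset.univ.filter fun i => j ∈ rowSupport W i).card : ℂ) = p := by
    simpa [rowSupport] using h
  exact_mod_cast this

/-- Rows with supports meeting in a single point have an inner product of modulus one. -/
theorem norm_mul_conjTranspose_apply_of_card_eq_one {n p : ℕ} {H K : Matrix (Fin n) (Fin n) ℂ}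
    (hH : IsUnitWeighing p H) (hK : IsUnitWeighing p K) {i j : Fin n}
    (h : (rowSupport H i ∩ rowSupport K j).card = 1) :
    ‖(H * K.conjTranspose) i j‖ = 1 := by
  obtain ⟨x, hx⟩ := Finset.card_eq_one.1 h
  have hxm : x ∈ rowSupport H i ∩ rowSupport K j := by simp [hx]
  rw [Matrix.mul_apply, Finset.sum_eq_single x]
  · have h1 : ‖H i x‖ = 1 := by simpa [rowSupport] using (Finset.mem_inter.1 hxm).1
    have h2 : ‖K j x‖ = 1 := by simpa [rowSupport] using (Finset.mem_inter.1 hxm).2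
    rw [Matrix.conjTranspose_apply, norm_mul, norm_star, h1, h2, one_mul]
  · intro y _ hyx
    by_cases hy : y ∈ rowSupport H i
    · have hy' : y ∉ rowSupport K j := by
        intro hy'
        have : y ∈ rowSupport H i ∩ rowSupport K j := Finset.mem_inter.2 ⟨hy, hy'⟩
        rw [hx, Finset.mem_singleton] at this
        exact hyx this
      rw [Matrix.conjTranspose_apply, hK.eq_zero_of_notMem hy', star_zero, mul_zero]
    · rw [hH.eq_zero_of_notMem hy, zero_mul]
  · simp

theorem AreUnbiased.normSq_mul_conjTranspose {n p : ℕ} {H K : Matrix (Fin n) (Fin n) ℂ}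
    (h : AreUnbiased p H K) (i j : Fin n) :
    Complex.normSq ((H * K.conjTranspose) i j) = 0 ∨
      Complex.normSq ((H * K.conjTranspose) i j) = p := by
  obtain ⟨L, hL, e⟩ := h
  rw [e, Matrix.smul_apply, smul_eq_mul, map_mul, Complex.normSq_ofReal,
    Real.mul_self_sqrt (Nat.cast_nonneg p), Complex.normSq_eq_norm_sq]
  rcases hL.norm_entry i j with h | h <;> simp [h]

/-- A single common point gives an inner product of modulus 1, whereas orthogonality allows only 0
between different rows of one matrix, and unbiasedness only 0 or √p between two matrices. A row
against itself meets in `p > 1` points. -/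
theorem IsMutuallyUnbiased.card_inter_rowSupport_ne_one {n p : ℕ} (hp : 1 < p)
    {S : Set (Matrix (Fin n) (Fin n) ℂ)} (hS : IsMutuallyUnbiased p S)
    {H K : Matrix (Fin n) (Fin n) ℂ} (hH : H ∈ S) (hK : K ∈ S) (i j : Fin n) :
    (rowSupport H i ∩ rowSupport K j).card ≠ 1 := by
  intro hc
  by_cases hHK : H = K
  · subst hHK
    have h := norm_mul_conjTranspose_apply_of_card_eq_one (hS.isUnitWeighing H hH)
      (hS.isUnitWeighing H hK) hc
    rw [(hS.isUnitWeighing H hH).mul_conjTranspose] at h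
    by_cases hij : i = j
    · subst hij
      rw [Finset.inter_self, (hS.isUnitWeighing H hH).card_rowSupport] at hc
      omega
    · simp [Matrix.one_apply_ne hij] at h
  · have h := norm_mul_conjTranspose_apply_of_card_eq_one (hS.isUnitWeighing H hH)
      (hS.isUnitWeighing K hK) hc
    have h' := (hS.pairwise_unbiased hH hK hHK).normSq_mul_conjTranspose i j
    rw [Complex.normSq_eq_norm_sq, h] at h'
    rcases h' with h' | h'
    · norm_num at h'
    · have : p = 1 := by
        have : ((p : ℕ) : ℝ) = ((1 : ℕ) : ℝ) := by rw [← h']; norm_num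
        exact_mod_cast this
      omega

/-! ### The bound for mutually unbiased sets. -/

/-- A finite set of mutually unbiased `UW(n, 3)` whose row supports do not cross `B`: the Welch bound
for its members together with `√3 I`. -/
theorem IsMutuallyUnbiased.card_bound {n : ℕ} {S : Set (Matrix (Fin n) (Fin n) ℂ)}
    (hS : IsMutuallyUnbiased 3 S) (B : Finset (Fin n)) (hB : B.Nonempty)
    (hpure : ∀ W ∈ S, ∀ i, (∀ x ∈ rowSupport W i, x ∈ B) ∨ ∀ x ∈ rowSupport W i, x ∉ B)
    (F : Finset (Matrix (Fin n) (Fin n) ℂ)) (hF : (F : Set _) ⊆ S) :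
    6 * (F.card + 1) ≤ (B.card + 1) * (3 + F.card) := by
  classical
  set c : ℂ := ((Real.sqrt 3 : ℝ) : ℂ) with hc
  have hcc : c * star c = 3 := by
    rw [hc, Complex.star_def, Complex.conj_ofReal, ← Complex.ofReal_mul,
      Real.mul_self_sqrt (by norm_num)]
    norm_num
  have hcn : Complex.normSq c = 3 := by
    rw [hc, Complex.normSq_ofReal, Real.mul_self_sqrt (by norm_num)]
  have hns : ∀ W ∈ S, ∀ i j, Complex.normSq (c * W i j) = 0 ∨ Complex.normSq (c * W i j) = 3 := by
    intro W hW i j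
    rw [map_mul, hcn, Complex.normSq_eq_norm_sq]
    rcases (hS.isUnitWeighing W hW).norm_entry i j with h | h <;> simp [h]
  -- `none` carries √3 I; its products with a member `W` are √3 W and √3 W*, so it behaves as one
  -- more unbiased matrix.
  let M : Option F → Matrix (Fin n) (Fin n) ℂ := fun o =>
    o.elim (c • (1 : Matrix (Fin n) (Fin n) ℂ)) fun W => W
  have key := card_bound_of_pure M B hB ?_ ?_ ?_
  · simp only [Fintype.card_option, Fintype.card_coe] at key
    linarith
  · rintro (_ | W)
    · simp only [M, Option.elim_none, Matrix.conjTranspose_smul, Matrix.conjTranspose_one,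
        Matrix.mul_smul, Matrix.mul_one, smul_smul, mul_comm (star c), hcc]
    · simpa [M] using (hS.isUnitWeighing W (hF W.2)).mul_conjTranspose
  · rintro (_ | W) i
    · simp only [M, Option.elim_none, Matrix.smul_apply, smul_eq_mul]
      by_cases hi : i ∈ B
      · right
        intro j hj
        rw [Matrix.one_apply_ne (by rintro rfl; exact hj hi), mul_zero]
      · left
        intro j hj
        rw [Matrix.one_apply_ne (by rintro rfl; exact hi hj), mul_zero]
    · simp only [M, Option.elim_some]
      have hW := hS.isUnitWeighing W (hF W.2)
      rcases hpure W (hF W.2) i with h | h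
      · exact Or.inr fun j hj => hW.eq_zero_of_notMem fun h' => hj (h j h')
      · exact Or.inl fun j hj => hW.eq_zero_of_notMem fun h' => h j h' hj
  · rintro (_ | W) (_ | W') hne i j
    · exact absurd rfl hne
    · simp only [M, Option.elim_none, Option.elim_some, Matrix.smul_mul, Matrix.one_mul,
        Matrix.smul_apply, smul_eq_mul, Matrix.conjTranspose_apply]
      have := hns W' (hF W'.2) j i
      rw [map_mul] at this ⊢
      rwa [Complex.star_def, Complex.normSq_conj]
    · simp only [M, Option.elim_none, Option.elim_some, Matrix.conjTranspose_smul,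
        Matrix.conjTranspose_one, Matrix.mul_smul, Matrix.mul_one,
        Matrix.smul_apply, smul_eq_mul]
      have := hns W (hF W.2) i j
      rw [map_mul] at this ⊢
      rwa [Complex.star_def, Complex.normSq_conj]
    · have hWW : (W : Matrix (Fin n) (Fin n) ℂ) ≠ W' := fun h => hne (by rw [Subtype.ext h])
      simpa [M] using
        (hS.pairwise_unbiased (hF W.2) (hF W'.2) hWW).normSq_mul_conjTranspose i j

/-- The Welch argument needs finite families; this passes to `S` itself and delivers its finiteness
as well. -/
theorem Set.encard_le_of_forall_finset_card_le {α : Type*} {S : Set α} {k : ℕ}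
    (h : ∀ F : Finset α, (F : Set α) ⊆ S → F.card ≤ k) : S.encard ≤ k := by
  by_contra! hlt
  have hk : ((k + 1 : ℕ) : ℕ∞) ≤ S.encard := by
    push_cast
    exact Order.add_one_le_of_lt hlt
  obtain ⟨T, hT, hTc⟩ := Set.exists_subset_encard_eq hk
  have hTf : T.Finite := Set.finite_of_encard_eq_coe hTc
  have := h hTf.toFinset (by simpa using hT)
  rw [hTf.encard_eq_coe_toFinset_card] at hTc
  have : hTf.toFinset.card = k + 1 := by exact_mod_cast hTc
  omega

theorem mainTheorem1 (n : ℕ) (hn : n = 3 ∨ n = 4 ∨ 6 ≤ n)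
    (S : Set (Matrix (Fin n) (Fin n) ℂ)) (hS : IsMutuallyUnbiased 3 S) :
    (¬ n ≡ 0 [MOD 4] → S.encard ≤ 3) ∧ (n ≡ 0 [MOD 4] → S.encard ≤ 9) := by
  rcases S.eq_empty_or_nonempty with rfl | ⟨W, hW⟩
  · simp
  have hUW := hS.isUnitWeighing W hW
  have hrow := hUW.card_rowSupport
  have hcol := hUW.card_filter_mem_rowSupport (by norm_num)
  have hmeet := fun i j => hS.card_inter_rowSupport_ne_one (by norm_num) hW hW i j
  have hblock := starUnion_card_and_pure (rowSupport W) hrow hcol hmeet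
  have hbound : ∀ a, ∀ F : Finset (Matrix (Fin n) (Fin n) ℂ), (F : Set _) ⊆ S →
      6 * (F.card + 1) ≤ ((starUnion (rowSupport W) a).card + 1) * (3 + F.card) := by
    intro a
    obtain ⟨hcard, hpure⟩ := hblock a
    refine hS.card_bound _ (Finset.card_pos.1 (by omega)) fun W' hW' i => ?_
    exact hpure _ ((hS.isUnitWeighing W' hW').card_rowSupport i) fun j =>
      hS.card_inter_rowSupport_ne_one (by norm_num) hW' hW i j
  constructor
  · intro h
    obtain ⟨a, ha⟩ := exists_starUnion_card_eq_three (rowSupport W) hrow hcol hmeet h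
    refine Set.encard_le_of_forall_finset_card_le (k := 3) fun F hF => ?_
    have := hbound a F hF
    rw [ha] at this
    omega
  · intro _
    refine Set.encard_le_of_forall_finset_card_le (k := 9) fun F hF => ?_
    have a : Fin n := ⟨0, by omega⟩
    have := hbound a F hF
    rcases (hblock a).1 with ha | ha <;> rw [ha] at this <;> omega
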